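/- Let $M$ be an orientable smooth manifold of dimension $m\ge 1$ (Hausdorff, second countable, without boundary), let $X$ be a smooth vector field on $M$, and let $h_1,\dots,h_{m-1}\in C^\infty(M)$ be independent first integrals of $X$: that is, $dh_j(X)=0$ for all $j$, and the covectors $dh_1(x),\dots,dh_{m-1}(x)$ are linearly independent at every point $x\in M$. For a smooth bivector field $\pi$ on $M$, let $\pi^\sharp:T^*M\to TM$ be given by $\beta(\pi^\sharp\alpha)=\pi(\alpha,\beta)$, call $\dim \pi^\sharp(T^*_xM)$ the rank of $\pi$ at $x$, and call $\pi$ a Poisson structure if $[\pi,\pi]=0$, where $[\cdot,\cdot]$ is the Schouten–Nijenhuis bracket. Then there is exactly one family $\pi_1,\dots,\pi_{m-1}$ of Poisson structures on $M$, each of rank at most two at every point, such that $$\pi_i^\sharp\, dh_j=\delta_{ij}X\qquad\text{for all } i,j=1,\dots,m-1 .$$ Moreover, $[\pi_i,\pi_j]=0$ for all $i,j=1,\dots,m-1$. -/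

import Mathlib

open scoped Manifold ContDiff Topology

noncomputable section

namespace HamPoisson

/-! ### Bivectors on a finite-dimensional vector space

`⋀²V` is identified, as usual, with the alternating bilinear forms on `V*`, by
`(u ∧ v)(α, β) = α(u) β(v) - α(v) β(u)`; likewise `⋀³V` with alternating trilinear forms. -/

/-- Bivectors on `V`, as alternating bilinear forms on the dual of `V`. -/
abbrev Bivector (V : Type*) [AddCommGroup V] [Module ℝ V] [TopologicalSpace V]
    [IsTopologicalAddGroup V] [ContinuousSMul ℝ V] : Type _ :=
  (V →L[ℝ] ℝ) [⋀^Fin 2]→ₗ[ℝ] ℝ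

section LinearAlgebra

variable {V W : Type*}
  [AddCommGroup V] [Module ℝ V] [TopologicalSpace V] [IsTopologicalAddGroup V] [ContinuousSMul ℝ V]
  [AddCommGroup W] [Module ℝ W] [TopologicalSpace W] [IsTopologicalAddGroup W] [ContinuousSMul ℝ W]

/-- Push-forward of a bivector by a linear map: `(L_* P)(α, …) = P(α ∘ L, …)`. -/
def Bivector.push (L : V →L[ℝ] W) (P : Bivector V) : Bivector W :=
  P.compLinearMap (ContinuousLinearMap.precomp ℝ L).toLinearMap

variable [T2Space V] [FiniteDimensional ℝ V]

/-- The contraction `P♯ : V* → V`, `α ↦ i_α P`, written in a basis `b` of `V` as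
`P♯ α = ∑ l, P(α, bˡ) b_l`. By `apply_sharp` it is characterised by `β(P♯ α) = P(α, β)`. -/
def sharp (P : Bivector V) : (V →L[ℝ] ℝ) →ₗ[ℝ] V where
  toFun α := ∑ l, P ![α, LinearMap.toContinuousLinearMap ((Module.finBasis ℝ V).coord l)] •
    Module.finBasis ℝ V l
  map_add' α β := by
    rw [← Finset.sum_add_distrib]
    refine Finset.sum_congr rfl fun l _ => ?_
    rw [← add_smul]
    congr 1
    exact P.toMultilinearMap.cons_add _ α β
  map_smul' c α := by
    rw [RingHom.id_apply, Finset.smul_sum]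
    refine Finset.sum_congr rfl fun l _ => ?_
    rw [smul_smul]
    congr 1
    exact P.toMultilinearMap.cons_smul _ c α

theorem apply_sharp (P : Bivector V) (α β : V →L[ℝ] ℝ) : β (sharp P α) = P ![α, β] := by
  have hβ : β = ∑ l, β (Module.finBasis ℝ V l) •
      LinearMap.toContinuousLinearMap ((Module.finBasis ℝ V).coord l) := by
    ext v
    have hv := congrArg β ((Module.finBasis ℝ V).sum_repr v)
    simp only [map_sum, map_smul, smul_eq_mul] at hv
    simp [← hv, mul_comm]
  let φ : (V →L[ℝ] ℝ) →ₗ[ℝ] ℝ := P.toMultilinearMap.toLinearMap ![α, 0] 1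
  have hφ : ∀ γ, φ γ = P ![α, γ] := by
    intro γ
    change P (Function.update ![α, 0] 1 γ) = _
    congr 1
    ext i
    fin_cases i <;> simp
  have h := congrArg φ hβ
  rw [map_sum φ] at h
  simp only [φ.map_smul, smul_eq_mul] at h
  simp only [hφ] at h
  rw [h]
  simp [sharp, mul_comm]

end LinearAlgebra

/-! ### The Schouten bracket of bivector fields on a vector space -/

/-- The Schouten–Nijenhuis bracket of two bivector fields `A`, `B` on a finite-dimensional vector
space, at the point `y`, evaluated on three covectors. In linear coordinates it is the trivector
`[A, B] = ∑ l, (∂A/∂ζ_l ∂B/∂x^l + ∂B/∂ζ_l ∂A/∂x^l)`, whose components are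
`[A, B]ⁱʲᵏ = ∑ l, (Aⁱˡ ∂_l Bʲᵏ + Aʲˡ ∂_l Bᵏⁱ + Aᵏˡ ∂_l Bⁱʲ
  + Bⁱˡ ∂_l Aʲᵏ + Bʲˡ ∂_l Aᵏⁱ + Bᵏˡ ∂_l Aⁱʲ)`.
Note that `∑ l, A(α, dxˡ) ∂_l` is the derivative in the direction of the vector `A♯ α`. -/
def localSchouten {E : Type*} [NormedAddCommGroup E] [NormedSpace ℝ E] [FiniteDimensional ℝ E]
    (A B : E → Bivector E) (y : E) (α β γ : E →L[ℝ] ℝ) : ℝ :=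
  (fderiv ℝ (fun z => B z ![β, γ]) y (sharp (A y) α)
    + fderiv ℝ (fun z => B z ![γ, α]) y (sharp (A y) β)
    + fderiv ℝ (fun z => B z ![α, β]) y (sharp (A y) γ))
  + (fderiv ℝ (fun z => A z ![β, γ]) y (sharp (B y) α)
    + fderiv ℝ (fun z => A z ![γ, α]) y (sharp (B y) β)
    + fderiv ℝ (fun z => A z ![α, β]) y (sharp (B y) γ))

/-! ### Manifolds -/

section Manifold

/-- The model space of an `m`-dimensional manifold. -/
abbrev Model (m : ℕ) : Type := EuclideanSpace ℝ (Fin m)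

variable {m : ℕ} {M : Type*} [TopologicalSpace M] [ChartedSpace (Model m) M]

instance (x : M) : T2Space (TangentSpace (𝓡 m) x) := inferInstanceAs (T2Space (Model m))

instance (x : M) : FiniteDimensional ℝ (TangentSpace (𝓡 m) x) :=
  inferInstanceAs (FiniteDimensional ℝ (Model m))

variable (m M) in
/-- `M` is orientable: its maximal smooth atlas contains a covering family of charts whose
coordinate changes have positive Jacobian determinants. -/
def IsOrientable : Prop :=
  ∃ A ⊆ IsManifold.maximalAtlas (𝓡 m) ∞ M,
    (∀ x : M, ∃ e ∈ A, x ∈ e.source) ∧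
    ∀ e ∈ A, ∀ e' ∈ A, ∀ y ∈ (e.symm.trans e').source,
      0 < (fderiv ℝ (e.symm.trans e' : Model m → Model m) y).det

/-- The differential `df` at `x`, as a covector. -/
def diff (f : M → ℝ) (x : M) : TangentSpace (𝓡 m) x →L[ℝ] ℝ := mfderiv (𝓡 m) 𝓘(ℝ, ℝ) f x

/-- The derivative at `x` of a chart `e`, from the tangent space to the model space. -/
def chartDeriv (e : OpenPartialHomeomorph M (Model m)) (x : M) :
    TangentSpace (𝓡 m) x →L[ℝ] Model m := mfderiv (𝓡 m) (𝓡 m) e x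

/-- The expression in a chart `e` of a (not necessarily smooth) field of bivectors. -/
def inChart (P : ∀ x : M, Bivector (TangentSpace (𝓡 m) x))
    (e : OpenPartialHomeomorph M (Model m)) (y : Model m) : Bivector (Model m) :=
  (P (e.symm y)).push (chartDeriv e (e.symm y))

variable (m M) in
/-- Smooth bivector fields: fields of bivectors whose components in the charts of the atlas
are smooth. -/
@[ext]
structure BivectorField where
  /-- The bivector at each point. -/
  toFun : ∀ x : M, Bivector (TangentSpace (𝓡 m) x)
  smooth : ∀ e ∈ atlas (Model m) M, ∀ α β : Model m →L[ℝ] ℝ,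
    ContDiffOn ℝ ∞ (fun y => inChart toFun e y ![α, β]) e.target

/-- The bundle map `π♯ : T*M → TM` at the point `x`. -/
def BivectorField.sharpAt (π : BivectorField m M) (x : M) :
    (TangentSpace (𝓡 m) x →L[ℝ] ℝ) →ₗ[ℝ] TangentSpace (𝓡 m) x :=
  sharp (π.toFun x)

/-- The rank of `π` at `x`, the dimension of `π♯(T*ₓM)`. -/
def BivectorField.rank (π : BivectorField m M) (x : M) : ℕ :=
  Module.finrank ℝ (LinearMap.range (π.sharpAt x))

/-- The Schouten–Nijenhuis bracket of two bivector fields, a field of trivectors, evaluated on three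
covectors at `x`. It is given by the coordinate formula in the preferred chart at `x`, transported
back to the tangent space (the coordinate formula does not depend on the chart). -/
def schouten (π σ : BivectorField m M) (x : M) (α β γ : TangentSpace (𝓡 m) x →L[ℝ] ℝ) : ℝ :=
  localSchouten (inChart π.toFun (chartAt (Model m) x)) (inChart σ.toFun (chartAt (Model m) x))
    (chartAt (Model m) x x)
    (α.comp (chartDeriv (chartAt (Model m) x) x).inverse)
    (β.comp (chartDeriv (chartAt (Model m) x) x).inverse)
    (γ.comp (chartDeriv (chartAt (Model m) x) x).inverse)

/-- The Schouten–Nijenhuis bracket of `π` and `σ` vanishes: `[π, σ] = 0`. -/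
def SchoutenCommute (π σ : BivectorField m M) : Prop :=
  ∀ (x : M) (α β γ : TangentSpace (𝓡 m) x →L[ℝ] ℝ), schouten π σ x α β γ = 0

/-- `π` is a Poisson structure: `[π, π] = 0`. -/
def BivectorField.IsPoisson (π : BivectorField m M) : Prop := SchoutenCommute π π

end Manifold

end HamPoisson

end

/-! At each point the `m - 1` independent covectors `dh_j` span a hyperplane of the cotangent space;
let `κ` be one more covector spanning a complement. A bivector `P` is then determined by its
contractions with the `dh_j`, since the only value left over is `P(κ, κ) = 0`. This is
`Bivector.eq_of_forall_apply_eq`, and it gives uniqueness pointwise. For existence take `π_i = v_i ∧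
X` with `dh_j(v_i) = δ_ij`; its rank is at most two. The `v_i` may be chosen point by point: by
uniqueness the wedge does not depend on the choice, and near any point it equals `Y ∧ X` with the
smooth `Y` of `exists_contDiffAt_dual`. The bracket `[π_i, π_j]` is trilinear and alternating in its
covectors, so by the same corank argument it suffices to evaluate it on `(dh_a, dh_b, γ)`.
Differentiating `π_i(dh_k, γ) = δ_ik γ(X)` and `dh_k(X) = 0` expresses every term through `DX` and
the Hessians of the `h_k`, and symmetry of the Hessians makes the sum vanish
(`localSchouten_eq_zero`). The case `i = j` is the Poisson condition. -/

namespace HamPoisson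

/-! ### Bivectors and covectors on a single vector space -/

section LinearAlgebra

/-- Linearly independent covectors can be given arbitrary values on a vector. -/
theorem exists_forall_apply_eq {V : Type*} [AddCommGroup V] [Module ℝ V]
    [TopologicalSpace V] {ι : Type*} [Fintype ι] {θ : ι → V →L[ℝ] ℝ} (hθ : LinearIndependent ℝ θ) (c : ι → ℝ) :
    ∃ v : V, ∀ j, θ j v = c j := by
  classical
  let Θ : V →ₗ[ℝ] ι → ℝ := LinearMap.pi fun j => (θ j : V →ₗ[ℝ] ℝ)
  suffices hΘ : LinearMap.range Θ = ⊤ by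
    obtain ⟨v, hv⟩ := LinearMap.range_eq_top.1 hΘ c
    exact ⟨v, fun j => congrFun hv j⟩
  by_contra hne
  obtain ⟨f, hf, hle⟩ := Submodule.exists_le_ker_of_lt_top _ (lt_top_iff_ne_top.2 hne)
  apply hf
  -- A functional vanishing on the range is a linear relation among the `θ j`.
  have hsum : ∑ j, f (Pi.single j 1) • θ j = 0 := by
    ext v
    have h1 : f (Θ v) = 0 := hle ⟨v, rfl⟩
    rw [LinearMap.pi_apply_eq_sum_univ f] at h1
    have h2 : ∀ j : ι, (Pi.single j 1 : ι → ℝ) = fun k => if j = k then 1 else 0 := fun j => by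
      ext k
      simp [Pi.single_apply, eq_comm]
    simpa [Θ, mul_comm, h2] using h1
  have h0 := Fintype.linearIndependent_iff.1 hθ _ hsum
  ext j
  simpa using h0 j

variable {V W : Type*}
  [AddCommGroup V] [Module ℝ V] [TopologicalSpace V] [IsTopologicalAddGroup V] [ContinuousSMul ℝ V]
  [AddCommGroup W] [Module ℝ W] [TopologicalSpace W] [IsTopologicalAddGroup W] [ContinuousSMul ℝ W]

theorem Bivector.apply_swap (P : Bivector V) (α β : V →L[ℝ] ℝ) : P ![β, α] = -P ![α, β] := by
  rw [← P.map_swap ![α, β] (i := 0) (j := 1) (by decide)]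
  congr 1
  ext i
  fin_cases i <;> simp

theorem Bivector.apply_self (P : Bivector V) (α : V →L[ℝ] ℝ) : P ![α, α] = 0 :=
  P.map_eq_zero_of_eq ![α, α] (i := 0) (j := 1) rfl (by decide)

theorem Bivector.apply_add_left (P : Bivector V) (α α' β : V →L[ℝ] ℝ) :
    P ![α + α', β] = P ![α, β] + P ![α', β] :=
  P.toMultilinearMap.cons_add _ α α'

theorem Bivector.apply_smul_left (P : Bivector V) (c : ℝ) (α β : V →L[ℝ] ℝ) :
    P ![c • α, β] = c * P ![α, β] :=
  P.toMultilinearMap.cons_smul _ c α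

/-- A bivector as a bilinear form on covectors. -/
noncomputable def Bivector.bilin (P : Bivector V) :
    (V →L[ℝ] ℝ) →ₗ[ℝ] (V →L[ℝ] ℝ) →ₗ[ℝ] ℝ :=
  LinearMap.mk₂ ℝ (fun α β => P ![α, β]) P.apply_add_left P.apply_smul_left
    (fun α β γ => by
      rw [P.apply_swap _ α, P.apply_add_left, P.apply_swap _ β, P.apply_swap _ γ]; ring)
    (fun c α β => by
      rw [P.apply_swap _ α, P.apply_smul_left, P.apply_swap _ β, smul_eq_mul]; ring)

@[simp]
theorem Bivector.bilin_apply (P : Bivector V) (α β : V →L[ℝ] ℝ) :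
    P.bilin α β = P ![α, β] := rfl

theorem Bivector.ext_apply {P Q : Bivector V} (h : ∀ α β, P ![α, β] = Q ![α, β]) : P = Q := by
  ext v
  have hv : v = ![v 0, v 1] := by ext i; fin_cases i <;> simp
  rw [hv]
  exact h _ _

@[simp]
theorem Bivector.push_apply (L : V →L[ℝ] W) (P : Bivector V) (α β : W →L[ℝ] ℝ) :
    P.push L ![α, β] = P ![α.comp L, β.comp L] := by
  rw [Bivector.push, AlternatingMap.compLinearMap_apply]
  congr 1
  ext i
  fin_cases i <;> rfl

/-- The bivector `u ∧ v`. -/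
noncomputable def wedge (u v : V) : Bivector V :=
  (Matrix.detRowAlternating (n := Fin 2) (R := ℝ)).compLinearMap
    { toFun := fun α : V →L[ℝ] ℝ => ![α u, α v]
      map_add' := fun α β => by ext i; fin_cases i <;> simp
      map_smul' := fun c α => by ext i; fin_cases i <;> simp }

@[simp]
theorem wedge_apply (u v : V) (α β : V →L[ℝ] ℝ) :
    wedge u v ![α, β] = α u * β v - α v * β u := by
  change Matrix.det (Matrix.of fun k : Fin 2 => ![(![α, β] k) u, (![α, β] k) v]) = _
  simp [Matrix.det_fin_two]

theorem wedge_apply_of_dual {ι : Type*} [DecidableEq ι] {θ : ι → V →L[ℝ] ℝ} {i : ι} {u v : V}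
    (hu : ∀ j, θ j u = if i = j then 1 else 0) (hv : ∀ j, θ j v = 0) (j : ι) (β : V →L[ℝ] ℝ) :
    wedge u v ![θ j, β] = (if i = j then 1 else 0) * β v := by
  simp [hu, hv]

variable [T2Space V] [FiniteDimensional ℝ V] {ι : Type*} [Fintype ι]

/-- A linearly independent family of covectors of corank one spans, together with one more
covector, the dual space. -/
theorem exists_covector_complement {θ : ι → V →L[ℝ] ℝ} (hθ : LinearIndependent ℝ θ)
    (hV : Module.finrank ℝ V = Fintype.card ι + 1) :
    ∃ κ : V →L[ℝ] ℝ, ∀ α : V →L[ℝ] ℝ,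
      ∃ c : ℝ, ∃ η ∈ Submodule.span ℝ (Set.range θ), α = η + c • κ := by
  have e : Module.Dual ℝ V ≃ₗ[ℝ] (V →L[ℝ] ℝ) := LinearMap.toContinuousLinearMap
  have : FiniteDimensional ℝ (V →L[ℝ] ℝ) := e.finiteDimensional
  have hd : Module.finrank ℝ (V →L[ℝ] ℝ) = Fintype.card ι + 1 := by
    rw [← e.finrank_eq, Subspace.dual_finrank_eq, hV]
  set S := Submodule.span ℝ (Set.range θ)
  have hS : Module.finrank ℝ S = Fintype.card ι := finrank_span_eq_card hθ
  have hQ : Module.finrank ℝ ((V →L[ℝ] ℝ) ⧸ S) = 1 := by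
    have := S.finrank_quotient_add_finrank
    omega
  obtain ⟨q, -, hq⟩ := finrank_eq_one_iff'.1 hQ
  obtain ⟨κ, rfl⟩ := S.mkQ_surjective q
  refine ⟨κ, fun α => ?_⟩
  obtain ⟨c, hc⟩ := hq (S.mkQ α)
  refine ⟨c, α - c • κ, ?_, by simp⟩
  rw [← S.ker_mkQ, LinearMap.mem_ker, map_sub, map_smul, hc, sub_self]

/-- A bivector is determined by its contractions with a linearly independent family of covectors
of corank one. -/
theorem Bivector.eq_of_forall_apply_eq {θ : ι → V →L[ℝ] ℝ} (hθ : LinearIndependent ℝ θ)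
    (hV : Module.finrank ℝ V = Fintype.card ι + 1) {P Q : Bivector V}
    (h : ∀ j β, P ![θ j, β] = Q ![θ j, β]) : P = Q := by
  obtain ⟨κ, hκ⟩ := exists_covector_complement hθ hV
  have hker : Submodule.span ℝ (Set.range θ) ≤ LinearMap.ker (P.bilin - Q.bilin) := by
    rw [Submodule.span_le]
    rintro _ ⟨j, rfl⟩
    simp only [SetLike.mem_coe, LinearMap.mem_ker]
    ext β
    simp [h]
  have hη : ∀ η ∈ Submodule.span ℝ (Set.range θ), ∀ β, P ![η, β] = Q ![η, β] := by
    intro η hη β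
    have := LinearMap.congr_fun (LinearMap.mem_ker.1 (hker hη)) β
    simpa [sub_eq_zero] using this
  refine Bivector.ext_apply fun α β => ?_
  obtain ⟨c, η, hηS, rfl⟩ := hκ α
  obtain ⟨d, ζ, hζS, rfl⟩ := hκ β
  -- In the bilinear expansion every term but the one at `(κ, κ)` has an argument in the span; that
  -- one vanishes for both bivectors.
  simp only [P.apply_add_left, Q.apply_add_left, P.apply_smul_left, Q.apply_smul_left, hη η hηS]
  rw [P.apply_swap _ κ, Q.apply_swap _ κ]
  simp only [P.apply_add_left, Q.apply_add_left, P.apply_smul_left, Q.apply_smul_left, hη ζ hζS,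
    P.apply_self, Q.apply_self]

theorem sharp_eq_iff (P : Bivector V) (α : V →L[ℝ] ℝ) (v : V) :
    sharp P α = v ↔ ∀ β, P ![α, β] = β v := by
  refine ⟨fun h β => by rw [← apply_sharp, h], fun h => ?_⟩
  have : ∀ f : Module.Dual ℝ V, f (sharp P α - v) = 0 := by
    intro f
    have h1 := apply_sharp P α (LinearMap.toContinuousLinearMap f)
    rw [h] at h1
    simpa [sub_eq_zero] using h1
  exact sub_eq_zero.1 ((Module.forall_dual_apply_eq_zero_iff ℝ _).1 this)

theorem sharp_wedge (u v : V) (α : V →L[ℝ] ℝ) : sharp (wedge u v) α = α u • v - α v • u := by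
  rw [sharp_eq_iff]
  simp

theorem finrank_range_sharp_wedge_le (u v : V) :
    Module.finrank ℝ (LinearMap.range (sharp (wedge u v))) ≤ 2 := by
  classical
  have hle : LinearMap.range (sharp (wedge u v)) ≤
      Submodule.span ℝ (({u, v} : Finset V) : Set V) := by
    rintro _ ⟨α, rfl⟩
    rw [sharp_wedge, Finset.coe_insert, Finset.coe_singleton]
    exact Submodule.mem_span_pair.2 ⟨-α v, α u, by rw [neg_smul]; abel⟩
  exact (Submodule.finrank_mono hle).trans
    ((finrank_span_finset_le_card _).trans Finset.card_le_two)

end LinearAlgebra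

/-! ### The Schouten bracket in coordinates -/

section Local

variable {E : Type*} [NormedAddCommGroup E] [NormedSpace ℝ E] [FiniteDimensional ℝ E]

set_option maxSynthPendingDepth 3 in
/-- The product rule for the pairing of a field of bivectors with two fields of covectors. -/
theorem fderiv_apply_pair {B : E → Bivector E} {U : Set E} (hU : IsOpen U)
    (hB : ∀ α β, ContDiffOn ℝ ∞ (fun z => B z ![α, β]) U) {y : E} (hy : y ∈ U)
    {θ η : E → E →L[ℝ] ℝ} (hθ : DifferentiableAt ℝ θ y) (hη : DifferentiableAt ℝ η y) (v : E) :
    fderiv ℝ (fun z => B z ![θ z, η z]) y v = fderiv ℝ (fun z => B z ![θ y, η y]) y v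
      + B y ![fderiv ℝ θ y v, η y] + B y ![θ y, fderiv ℝ η y v] := by
  -- Smoothness of `B` is given only componentwise. As a function into bounded bilinear forms, where
  -- smoothness can be tested componentwise, it can be differentiated as a whole.
  let C : E → (E →L[ℝ] ℝ) →L[ℝ] (E →L[ℝ] ℝ) →L[ℝ] ℝ := fun z =>
    LinearMap.toContinuousBilinearMap (B z).bilin
  have hC : DifferentiableAt ℝ C y := by
    have : ContDiffOn ℝ ∞ C U :=
      contDiffOn_clm_apply.2 fun α => contDiffOn_clm_apply.2 fun β => hB α β
    exact (this.contDiffAt (hU.mem_nhds hy)).differentiableAt (by simp)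
  have h1 := ((hC.hasFDerivAt.clm_apply hθ.hasFDerivAt).clm_apply hη.hasFDerivAt).fderiv
  have h2 := ((hC.hasFDerivAt.clm_apply (hasFDerivAt_const (θ y) y)).clm_apply
    (hasFDerivAt_const (η y) y)).fderiv
  have h3 := congrArg (fun L : E →L[ℝ] ℝ => L v) h1
  have h4 := congrArg (fun L : E →L[ℝ] ℝ => L v) h2
  change fderiv ℝ (fun z => B z ![θ z, η z]) y v = _ at h3
  change fderiv ℝ (fun z => B z ![θ y, η y]) y v = _ at h4
  rw [h3, h4]
  simp [C]
  ring

omit [FiniteDimensional ℝ E] in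
theorem fderiv_apply_add {B : E → Bivector E} {U : Set E} (hU : IsOpen U)
    (hB : ∀ α β, ContDiffOn ℝ ∞ (fun z => B z ![α, β]) U) {y : E} (hy : y ∈ U)
    (α α' β : E →L[ℝ] ℝ) (v : E) :
    fderiv ℝ (fun z => B z ![α + α', β]) y v =
      fderiv ℝ (fun z => B z ![α, β]) y v + fderiv ℝ (fun z => B z ![α', β]) y v := by
  have hd : ∀ α β, DifferentiableAt ℝ (fun z => B z ![α, β]) y := fun α β =>
    ((hB α β).contDiffAt (hU.mem_nhds hy)).differentiableAt (by simp)
  simp_rw [fun z => (B z).apply_add_left α α' β]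
  rw [fderiv_fun_add (hd _ _) (hd _ _)]
  rfl

omit [FiniteDimensional ℝ E] in
theorem fderiv_apply_smul {B : E → Bivector E} {U : Set E} (hU : IsOpen U)
    (hB : ∀ α β, ContDiffOn ℝ ∞ (fun z => B z ![α, β]) U) {y : E} (hy : y ∈ U)
    (c : ℝ) (α β : E →L[ℝ] ℝ) (v : E) :
    fderiv ℝ (fun z => B z ![c • α, β]) y v = c * fderiv ℝ (fun z => B z ![α, β]) y v := by
  have hd : ∀ α β, DifferentiableAt ℝ (fun z => B z ![α, β]) y := fun α β =>
    ((hB α β).contDiffAt (hU.mem_nhds hy)).differentiableAt (by simp)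
  simp_rw [fun z => (B z).apply_smul_left c α β]
  rw [fderiv_const_mul (hd _ _)]
  rfl

omit [FiniteDimensional ℝ E] in
theorem fderiv_apply_swap (B : E → Bivector E) (y : E) (α β : E →L[ℝ] ℝ) (v : E) :
    fderiv ℝ (fun z => B z ![α, β]) y v = -fderiv ℝ (fun z => B z ![β, α]) y v := by
  simp_rw [fun z => (B z).apply_swap β α]
  simp

/-- Cyclic invariance brings any covector to the first slot, so linearity is needed only there. -/
theorem localSchouten_rotate (A B : E → Bivector E) (y : E) (α β γ : E →L[ℝ] ℝ) :
    localSchouten A B y β γ α = localSchouten A B y α β γ := by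
  unfold localSchouten
  ring

theorem localSchouten_self (A B : E → Bivector E) (y : E) (α γ : E →L[ℝ] ℝ) :
    localSchouten A B y α α γ = 0 := by
  have h0 : ∀ P : E → Bivector E, ∀ v, fderiv ℝ (fun z => P z ![α, α]) y v = 0 := fun P v => by
    simp_rw [fun z => (P z).apply_self α]
    simp
  unfold localSchouten
  rw [fderiv_apply_swap B y α γ, fderiv_apply_swap A y α γ, h0, h0]
  ring

section Linear

variable {A B : E → Bivector E} {U : Set E} {y : E}

theorem localSchouten_add (hU : IsOpen U) (hy : y ∈ U)
    (hA : ∀ α β, ContDiffOn ℝ ∞ (fun z => A z ![α, β]) U)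
    (hB : ∀ α β, ContDiffOn ℝ ∞ (fun z => B z ![α, β]) U) (α α' β γ : E →L[ℝ] ℝ) :
    localSchouten A B y (α + α') β γ =
      localSchouten A B y α β γ + localSchouten A B y α' β γ := by
  unfold localSchouten
  simp only [fderiv_apply_swap _ y γ, map_add, fderiv_apply_add hU hA hy,
    fderiv_apply_add hU hB hy]
  ring

theorem localSchouten_smul (hU : IsOpen U) (hy : y ∈ U)
    (hA : ∀ α β, ContDiffOn ℝ ∞ (fun z => A z ![α, β]) U)
    (hB : ∀ α β, ContDiffOn ℝ ∞ (fun z => B z ![α, β]) U) (c : ℝ) (α β γ : E →L[ℝ] ℝ) :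
    localSchouten A B y (c • α) β γ = c * localSchouten A B y α β γ := by
  unfold localSchouten
  simp only [fderiv_apply_swap _ y γ, map_smul, fderiv_apply_smul hU hA hy,
    fderiv_apply_smul hU hB hy, smul_eq_mul]
  ring

/-- The Schouten bracket vanishes if it vanishes whenever two of the covectors are taken from a
linearly independent family of corank one. -/
theorem localSchouten_eq_zero_of_pairs (hU : IsOpen U) (hy : y ∈ U)
    (hA : ∀ α β, ContDiffOn ℝ ∞ (fun z => A z ![α, β]) U)
    (hB : ∀ α β, ContDiffOn ℝ ∞ (fun z => B z ![α, β]) U)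
    {ι : Type*} [Fintype ι] {θ : ι → E →L[ℝ] ℝ} (hθ : LinearIndependent ℝ θ)
    (hE : Module.finrank ℝ E = Fintype.card ι + 1)
    (h : ∀ a b γ, localSchouten A B y (θ a) (θ b) γ = 0) (α β γ : E →L[ℝ] ℝ) :
    localSchouten A B y α β γ = 0 := by
  obtain ⟨κ, hκ⟩ := exists_covector_complement hθ hE
  have rot := localSchouten_rotate A B y
  have add := localSchouten_add hU hy hA hB
  have smul := localSchouten_smul hU hy hA hB
  have self := localSchouten_self A B y
  have span_left : ∀ β γ, (∀ a, localSchouten A B y (θ a) β γ = 0) →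
      ∀ η ∈ Submodule.span ℝ (Set.range θ), localSchouten A B y η β γ = 0 := by
    intro β γ hβγ η hη
    induction hη using Submodule.span_induction with
    | mem x hx => obtain ⟨a, rfl⟩ := hx; exact hβγ a
    | zero => simpa using smul 0 0 β γ
    | add x z _ _ hx hz => rw [add, hx, hz, add_zero]
    | smul c x _ hx => rw [smul, hx, mul_zero]
  have pairs : ∀ η ∈ Submodule.span ℝ (Set.range θ), ∀ ζ ∈ Submodule.span ℝ (Set.range θ), ∀ γ,
      localSchouten A B y η ζ γ = 0 := by
    intro η hη ζ hζ γ
    refine span_left ζ γ (fun a => ?_) η hη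
    rw [← rot]
    refine span_left γ (θ a) (fun b => ?_) ζ hζ
    rw [rot, h]
  have one : ∀ η ∈ Submodule.span ℝ (Set.range θ), ∀ β γ, localSchouten A B y η β γ = 0 := by
    intro η hη β γ
    obtain ⟨c, ζ, hζ, rfl⟩ := hκ β
    obtain ⟨d, ξ, hξ, rfl⟩ := hκ γ
    -- Only the term `(η, κ, κ)` lacks two covectors from the span, and alternation kills it.
    rw [← rot, add, smul, rot, pairs η hη ζ hζ, ← rot, add, smul, pairs ξ hξ η hη, ← rot,
      ← rot, self]
    ring
  obtain ⟨c, η, hη, rfl⟩ := hκ α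
  obtain ⟨d, ζ, hζ, rfl⟩ := hκ β
  rw [add, smul, one η hη, ← rot, add, smul, one ζ hζ, rot, rot, ← rot, self]
  ring

end Linear

variable {ι : Type*} [Fintype ι] [DecidableEq ι]

/-- Over an open set of a vector space, let `X` be a vector field with independent first
integrals `H k`. Bivector fields `A`, `B` with `A♯ (dH k) = δᵢₖ X` and `B♯ (dH k) = δⱼₖ X`
have vanishing Schouten bracket. -/
theorem localSchouten_eq_zero {A B : E → Bivector E} {U : Set E} {H : ι → E → ℝ} {X : E → E}
    {i j : ι} (hU : IsOpen U) (hE : Module.finrank ℝ E = Fintype.card ι + 1)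
    (hA : ∀ α β, ContDiffOn ℝ ∞ (fun z => A z ![α, β]) U)
    (hB : ∀ α β, ContDiffOn ℝ ∞ (fun z => B z ![α, β]) U)
    (hH : ∀ k, ContDiffOn ℝ ∞ (H k) U) (hX : ContDiffOn ℝ ∞ X U)
    (hHX : ∀ k, ∀ z ∈ U, fderiv ℝ (H k) z (X z) = 0)
    (hAH : ∀ k, ∀ z ∈ U, ∀ β, A z ![fderiv ℝ (H k) z, β] = (if i = k then 1 else 0) * β (X z))
    (hBH : ∀ k, ∀ z ∈ U, ∀ β, B z ![fderiv ℝ (H k) z, β] = (if j = k then 1 else 0) * β (X z))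
    {y : E} (hy : y ∈ U) (hind : LinearIndependent ℝ fun k => fderiv ℝ (H k) y)
    (α β γ : E →L[ℝ] ℝ) : localSchouten A B y α β γ = 0 := by
  refine localSchouten_eq_zero_of_pairs hU hy hA hB hind hE (fun a b γ => ?_) α β γ
  have hUy := hU.mem_nhds hy
  have hΘ : ∀ k, DifferentiableAt ℝ (fderiv ℝ (H k)) y := fun k =>
    (((hH k).contDiffAt hUy).fderiv_right (m := 1) (by norm_cast)).differentiableAt (by simp)
  have hXd : DifferentiableAt ℝ X y := (hX.contDiffAt hUy).differentiableAt (by simp)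
  have hsymm : ∀ k v w, fderiv ℝ (fderiv ℝ (H k)) y v w = fderiv ℝ (fderiv ℝ (H k)) y w v :=
    fun k => ((hH k).contDiffAt hUy).isSymmSndFDerivAt (by simp; norm_cast)
  -- Derivative of the first-integral identity `dH_k(X) = 0`.
  have hdX : ∀ k v, fderiv ℝ (H k) y (fderiv ℝ X y v) = -fderiv ℝ (fderiv ℝ (H k)) y v (X y) := by
    intro k v
    have h0 : (fun z => fderiv ℝ (H k) z (X z)) =ᶠ[𝓝 y] fun _ => 0 :=
      Filter.eventuallyEq_of_mem hUy (hHX k)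
    have h1 := congrArg (fun L : E →L[ℝ] ℝ => L v) h0.fderiv_eq
    rw [fderiv_clm_apply (hΘ k) hXd] at h1
    simp at h1
    linarith
  -- Derivative of `P(dH_k, γ) = δ_pk γ(X)`. The bracket differentiates with covectors frozen at
  -- `y`, so the variation of `dH_k` is moved across and becomes the Hessian term.
  have key : ∀ (P : E → Bivector E) (p : ι),
      (∀ α β, ContDiffOn ℝ ∞ (fun z => P z ![α, β]) U) →
      (∀ k, ∀ z ∈ U, ∀ β, P z ![fderiv ℝ (H k) z, β] = (if p = k then 1 else 0) * β (X z)) →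
      ∀ k γ v, fderiv ℝ (fun z => P z ![fderiv ℝ (H k) y, γ]) y v =
        (if p = k then 1 else 0) * γ (fderiv ℝ X y v)
          + fderiv ℝ (fderiv ℝ (H k)) y v (sharp (P y) γ) := by
    intro P p hP hPH k γ v
    have h0 : (fun z => P z ![fderiv ℝ (H k) z, γ]) =ᶠ[𝓝 y]
        fun z => (if p = k then 1 else 0) * γ (X z) :=
      Filter.eventuallyEq_of_mem hUy fun z hz => hPH k z hz γ
    have h1 := fderiv_apply_pair hU hP hy (hΘ k) (differentiableAt_const γ) v
    have hγ : HasFDerivAt (fun z => (if p = k then (1 : ℝ) else 0) * γ (X z))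
        ((if p = k then (1 : ℝ) else 0) • γ.comp (fderiv ℝ X y)) y :=
      (γ.hasFDerivAt.comp y hXd.hasFDerivAt).const_mul _
    rw [h0.fderiv_eq, hγ.fderiv] at h1
    have h2 : P y ![fderiv ℝ (H k) y, fderiv ℝ (fun _ : E => γ) y v] = 0 := by
      rw [hPH k y hy]
      simp
    rw [h2, (P y).apply_swap γ, ← apply_sharp] at h1
    simp only [smul_apply, ContinuousLinearMap.comp_apply, smul_eq_mul] at h1
    linarith
  have hsharp : ∀ (P : E → Bivector E) (p : ι),
      (∀ k, ∀ z ∈ U, ∀ β, P z ![fderiv ℝ (H k) z, β] = (if p = k then 1 else 0) * β (X z)) →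
      ∀ k, sharp (P y) (fderiv ℝ (H k) y) = (if p = k then (1 : ℝ) else 0) • X y := by
    intro P p hPH k
    rw [sharp_eq_iff]
    intro β
    rw [hPH k y hy, map_smul, smul_eq_mul]
  unfold localSchouten
  rw [fderiv_apply_swap B y γ, fderiv_apply_swap A y γ]
  simp only [key A i hA hAH, key B j hB hBH, hsharp A i hAH, hsharp B j hBH, map_smul, smul_eq_mul,
    smul_apply, hdX]
  -- The `γ(DX X)` terms cancel between the two halves of the bracket. Each Hessian term from a
  -- derivative along `X` cancels one from a derivative along `A♯ γ` or `B♯ γ`, once its arguments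
  -- are swapped.
  rw [hsymm a (sharp (A y) γ), hsymm a (sharp (B y) γ), hsymm b (sharp (A y) γ),
    hsymm b (sharp (B y) γ)]
  ring

end Local
/-- Near a point where the differentials of smooth functions are independent, there is a smooth
vector field dual to one of them and annihilated by the others. -/
theorem exists_contDiffAt_dual {E : Type*} [NormedAddCommGroup E] [NormedSpace ℝ E]
    [FiniteDimensional ℝ E] {ι : Type*} [Fintype ι] [DecidableEq ι] {H : ι → E → ℝ} {y : E}
    (hH : ∀ k, ContDiffAt ℝ ∞ (H k) y) (hind : LinearIndependent ℝ fun k => fderiv ℝ (H k) y)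
    (i : ι) :
    ∃ Y : E → E, ContDiffAt ℝ ∞ Y y ∧
      ∀ᶠ z in 𝓝 y, ∀ j, fderiv ℝ (H j) z (Y z) = if i = j then 1 else 0 := by
  choose w hw using fun k : ι => exists_forall_apply_eq hind (Pi.single k 1)
  let R : (ι → ℝ) →L[ℝ] E := ∑ k, (ContinuousLinearMap.proj k : (ι → ℝ) →L[ℝ] ℝ).smulRight (w k)
  let Θ : E → E →L[ℝ] (ι → ℝ) := fun z =>
    ∑ k, (fderiv ℝ (H k) z).smulRight (Pi.single k 1 : ι → ℝ)
  have hΘ : ContDiffAt ℝ ∞ Θ y :=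
    ContDiffAt.sum fun k _ => ((hH k).fderiv_right (m := ∞) (by simp)).smulRight contDiffAt_const
  have hΘ_apply : ∀ z v j, Θ z v j = fderiv ℝ (H j) z v := fun z v j => by
    simp [Θ, Pi.single_apply]
  -- `R` is a right inverse of `Θ y`, so `G y = 1` and `G` stays invertible near `y`; `R ∘ G⁻¹` is
  -- then a smooth right inverse of `Θ`.
  let G : E → (ι → ℝ) →L[ℝ] (ι → ℝ) := fun z => (Θ z).comp R
  have hG : ContDiffAt ℝ ∞ G y := hΘ.clm_comp contDiffAt_const
  have hGy : G y = ((1 : ((ι → ℝ) →L[ℝ] (ι → ℝ))ˣ) : (ι → ℝ) →L[ℝ] (ι → ℝ)) := by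
    ext c j
    simp [G, hΘ_apply, R, hw, Pi.single_apply]
  have hinv : ContDiffAt ℝ ∞ (fun z => Ring.inverse (G z)) y := by
    refine ContDiffAt.comp (g := Ring.inverse) y ?_ hG
    rw [hGy]
    exact contDiffAt_ringInverse ℝ 1
  refine ⟨fun z => R (Ring.inverse (G z) (Pi.single i 1)),
    R.contDiff.contDiffAt.comp y (hinv.clm_apply contDiffAt_const), ?_⟩
  have hunit : ∀ᶠ z in 𝓝 y, IsUnit (G z) :=
    hG.continuousAt.eventually (Units.isOpen.mem_nhds (by rw [hGy]; exact Units.isUnit 1))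
  filter_upwards [hunit] with z hz j
  have h1 := congrArg (fun L : (ι → ℝ) →L[ℝ] (ι → ℝ) => L (Pi.single i 1) j)
    (Ring.mul_inverse_cancel _ hz)
  rw [← hΘ_apply]
  simpa [G, Pi.single_apply, eq_comm] using h1

/-! ### Transfer to the manifold through charts -/

section Manifold

variable {m : ℕ} {M : Type*} [TopologicalSpace M] [ChartedSpace (Model m) M]
  [IsManifold (𝓡 m) ∞ M] {e : OpenPartialHomeomorph M (Model m)}

omit [IsManifold (𝓡 m) ∞ M] in
theorem finrank_tangentSpace (x : M) : Module.finrank ℝ (TangentSpace (𝓡 m) x) = m :=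
  finrank_euclideanSpace_fin

theorem contDiffOn_comp_symm (he : e ∈ atlas (Model m) M) {f : M → ℝ}
    (hf : ContMDiff (𝓡 m) 𝓘(ℝ, ℝ) ∞ f) : ContDiffOn ℝ ∞ (f ∘ e.symm) e.target :=
  contMDiffOn_iff_contDiffOn.1 <| hf.comp_contMDiffOn <|
    contMDiffOn_symm_of_mem_maximalAtlas (IsManifold.subset_maximalAtlas he)

theorem fderiv_comp_chartDeriv (he : e ∈ atlas (Model m) M) {f : M → ℝ}
    (hf : ContMDiff (𝓡 m) 𝓘(ℝ, ℝ) ∞ f) {y : Model m} (hy : y ∈ e.target) :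
    (fderiv ℝ (f ∘ e.symm) y).comp (chartDeriv e (e.symm y)) = diff f (e.symm y) := by
  have hx : e.symm y ∈ e.source := e.map_target hy
  have hd : MDifferentiableAt (𝓡 m) 𝓘(ℝ, ℝ) (f ∘ e.symm) (e (e.symm y)) := by
    rw [e.right_inv hy]
    exact ((contDiffOn_comp_symm he hf).contDiffAt
      (e.open_target.mem_nhds hy)).differentiableAt (by simp) |>.mdifferentiableAt
  have h1 := mfderiv_comp (e.symm y) hd (mdifferentiableAt_atlas he hx)
  have h2 : (f ∘ e.symm) ∘ e =ᶠ[𝓝 (e.symm y)] f := by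
    filter_upwards [e.open_source.mem_nhds hx] with z hz
    simp [e.left_inv hz]
  rw [h2.mfderiv_eq] at h1
  unfold diff chartDeriv
  rw [h1, mfderiv_eq_fderiv, e.right_inv hy]
  rfl

/-- The expression of a vector field in a chart. -/
noncomputable def vectorInChart (X : ∀ x : M, TangentSpace (𝓡 m) x) (e : OpenPartialHomeomorph M (Model m))
    (y : Model m) : Model m :=
  chartDeriv e (e.symm y) (X (e.symm y))

/-- The chart expression is the fibre component of the tangent map of `e` applied to the section `X
∘ e.symm`. -/
theorem contDiffOn_vectorInChart (he : e ∈ atlas (Model m) M) {X : ∀ x : M, TangentSpace (𝓡 m) x}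
    (hX : ContMDiff (𝓡 m) (𝓡 m).tangent ∞ (fun x => (⟨x, X x⟩ : TangentBundle (𝓡 m) M))) :
    ContDiffOn ℝ ∞ (vectorInChart X e) e.target := by
  have h1 : ContMDiffOn (𝓡 m).tangent (𝓡 m).tangent ∞
      (tangentMapWithin (𝓡 m) (𝓡 m) e e.source) (Bundle.TotalSpace.proj ⁻¹' e.source) :=
    (contMDiffOn_of_mem_maximalAtlas (n := ∞)
      (IsManifold.subset_maximalAtlas he)).contMDiffOn_tangentMapWithin (by simp)
      e.open_source.uniqueMDiffOn
  have h2 : ContMDiffOn (𝓡 m) (𝓡 m).tangent ∞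
      ((fun x => (⟨x, X x⟩ : TangentBundle (𝓡 m) M)) ∘ e.symm) e.target :=
    hX.comp_contMDiffOn
      (contMDiffOn_symm_of_mem_maximalAtlas (IsManifold.subset_maximalAtlas he))
  have h3 := (contMDiff_snd_tangentBundle_modelSpace (n := ∞) (Model m) (𝓡 m)).comp_contMDiffOn
    (h1.comp h2 fun y hy => e.map_target hy)
  refine (contMDiffOn_iff_contDiffOn.1 h3).congr fun y hy => ?_
  have h4 : mfderivWithin (𝓡 m) (𝓡 m) e e.source (e.symm y) = mfderiv (𝓡 m) (𝓡 m) e (e.symm y) :=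
    mfderivWithin_of_isOpen e.open_source (e.map_target hy)
  change _ = mfderivWithin (𝓡 m) (𝓡 m) e e.source (e.symm y) (X (e.symm y))
  rw [h4]
  rfl

variable {ι : Type*} {h : ι → M → ℝ} {X : ∀ x : M, TangentSpace (𝓡 m) x}

/-- Pulling back by the chart derivative gives the independent `dh_j`, and a family with independent
image under a linear map is independent. -/
theorem linearIndependent_fderiv_comp_symm (he : e ∈ atlas (Model m) M)
    (hh : ∀ j, ContMDiff (𝓡 m) 𝓘(ℝ, ℝ) ∞ (h j))
    (hind : ∀ x, LinearIndependent ℝ fun j => diff (m := m) (h j) x)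
    {y : Model m} (hy : y ∈ e.target) :
    LinearIndependent ℝ fun j => fderiv ℝ (h j ∘ e.symm) y := by
  refine LinearIndependent.of_comp
    (ContinuousLinearMap.precomp ℝ (chartDeriv e (e.symm y))).toLinearMap ?_
  convert hind (e.symm y) using 2 with j
  exact fderiv_comp_chartDeriv he (hh j) hy

theorem fderiv_comp_symm_vectorInChart (he : e ∈ atlas (Model m) M) {f : M → ℝ}
    (hf : ContMDiff (𝓡 m) 𝓘(ℝ, ℝ) ∞ f) {y : Model m} (hy : y ∈ e.target)
    (v : ∀ x : M, TangentSpace (𝓡 m) x) :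
    fderiv ℝ (f ∘ e.symm) y (vectorInChart v e y) = diff f (e.symm y) (v (e.symm y)) := by
  rw [← fderiv_comp_chartDeriv he hf hy]
  rfl

omit [IsManifold (𝓡 m) ∞ M] in
theorem sharpAt_diff_eq_iff [DecidableEq ι] (π : BivectorField m M) (i j : ι) (x : M) :
    π.sharpAt x (diff (h j) x) = (if i = j then X x else 0) ↔
      ∀ β, π.toFun x ![diff (h j) x, β] = (if i = j then 1 else 0) * β (X x) := by
  rw [BivectorField.sharpAt, sharp_eq_iff]
  split_ifs <;> simp

theorem inChart_apply_fderiv [DecidableEq ι] (he : e ∈ atlas (Model m) M) {j : ι}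
    (hh : ContMDiff (𝓡 m) 𝓘(ℝ, ℝ) ∞ (h j)) {P : ∀ x : M, Bivector (TangentSpace (𝓡 m) x)} {i : ι}
    (hP : ∀ x β, P x ![diff (h j) x, β] = (if i = j then 1 else 0) * β (X x))
    {y : Model m} (hy : y ∈ e.target) (β : Model m →L[ℝ] ℝ) :
    inChart P e y ![fderiv ℝ (h j ∘ e.symm) y, β] =
      (if i = j then 1 else 0) * β (vectorInChart X e y) := by
  rw [inChart, Bivector.push_apply, fderiv_comp_chartDeriv he hh hy, hP]
  rfl

variable [Fintype ι] [DecidableEq ι]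

/-- Bivector fields `π`, `σ` with `π♯ (dhₖ) = δᵢₖ X` and `σ♯ (dhₖ) = δⱼₖ X`, where the functions
`hₖ` are independent first integrals of `X`, have vanishing Schouten bracket. -/
theorem schoutenCommute_of_sharpAt_diff (hm : m = Fintype.card ι + 1)
    (hX : ContMDiff (𝓡 m) (𝓡 m).tangent ∞ (fun x => (⟨x, X x⟩ : TangentBundle (𝓡 m) M)))
    (hh : ∀ j, ContMDiff (𝓡 m) 𝓘(ℝ, ℝ) ∞ (h j))
    (hfirst : ∀ j x, diff (m := m) (h j) x (X x) = 0)
    (hind : ∀ x, LinearIndependent ℝ fun j => diff (m := m) (h j) x)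
    {π σ : BivectorField m M} {i j : ι}
    (hπ : ∀ k x, π.sharpAt x (diff (h k) x) = if i = k then X x else 0)
    (hσ : ∀ k x, σ.sharpAt x (diff (h k) x) = if j = k then X x else 0) :
    SchoutenCommute π σ := by
  intro x α β γ
  have he := chart_mem_atlas (Model m) x
  have hy := mem_chart_target (Model m) x
  exact localSchouten_eq_zero (i := i) (j := j)
    (H := fun k => h k ∘ (chartAt (Model m) x).symm)
    (X := vectorInChart X (chartAt (Model m) x)) (chartAt (Model m) x).open_target
    (finrank_euclideanSpace_fin.trans hm) (π.smooth _ he) (σ.smooth _ he)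
    (fun k => contDiffOn_comp_symm he (hh k)) (contDiffOn_vectorInChart he hX)
    (fun k z hz => (fderiv_comp_symm_vectorInChart he (hh k) hz X).trans (hfirst k _))
    (fun k z hz => inChart_apply_fderiv he (hh k)
      (fun x => (sharpAt_diff_eq_iff π i k x).1 (hπ k x)) hz)
    (fun k z hz => inChart_apply_fderiv he (hh k)
      (fun x => (sharpAt_diff_eq_iff σ j k x).1 (hσ k x)) hz)
    hy (linearIndependent_fderiv_comp_symm he hh hind hy) _ _ _

/-- If `X` has independent first integrals `hₖ`, then `v ∧ X` is a smooth bivector field for every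
(possibly discontinuous) vector field `v` with `dhₖ(v) = δᵢₖ`. -/
noncomputable def wedgeField (hm : m = Fintype.card ι + 1)
    (hX : ContMDiff (𝓡 m) (𝓡 m).tangent ∞ (fun x => (⟨x, X x⟩ : TangentBundle (𝓡 m) M)))
    (hh : ∀ j, ContMDiff (𝓡 m) 𝓘(ℝ, ℝ) ∞ (h j))
    (hfirst : ∀ j x, diff (m := m) (h j) x (X x) = 0)
    (hind : ∀ x, LinearIndependent ℝ fun j => diff (m := m) (h j) x)
    (i : ι) (v : ∀ x : M, TangentSpace (𝓡 m) x)
    (hv : ∀ x j, diff (h j) x (v x) = if i = j then 1 else 0) : BivectorField m M where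
  toFun x := wedge (v x) (X x)
  smooth e he α β y hy := by
    have hXe := (contDiffOn_vectorInChart he hX).contDiffAt (e.open_target.mem_nhds hy)
    obtain ⟨Y, hY, hYH⟩ := exists_contDiffAt_dual
      (fun k => (contDiffOn_comp_symm he (hh k)).contDiffAt (e.open_target.mem_nhds hy))
      (linearIndependent_fderiv_comp_symm he hh hind hy) i
    have hsmooth : ContDiffAt ℝ ∞
        (fun z => α (Y z) * β (vectorInChart X e z) - α (vectorInChart X e z) * β (Y z)) y :=
      ((α.contDiff.contDiffAt.comp y hY).mul (β.contDiff.contDiffAt.comp y hXe)).sub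
        ((α.contDiff.contDiffAt.comp y hXe).mul (β.contDiff.contDiffAt.comp y hY))
    refine (hsmooth.congr_of_eventuallyEq ?_).contDiffWithinAt
    filter_upwards [hYH, e.open_target.mem_nhds hy] with z hz hze
    rw [← wedge_apply]
    congr 1
    -- Both bivectors contract with the `dh_j` in the same way, so the pointwise choice of `v` does
    -- not matter.
    refine Bivector.eq_of_forall_apply_eq (linearIndependent_fderiv_comp_symm he hh hind hze)
      (finrank_euclideanSpace_fin.trans hm) fun j γ => ?_
    rw [wedge_apply_of_dual hz fun k =>
      (fderiv_comp_symm_vectorInChart he (hh k) hze X).trans (hfirst k _)]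
    exact inChart_apply_fderiv he (hh j)
      (fun x => wedge_apply_of_dual (hv x) (fun k => hfirst k x) j) hze γ

end Manifold

end HamPoisson

theorem theorem3p1 (m : ℕ) (hm : 1 ≤ m) {M : Type*} [TopologicalSpace M] [T2Space M]
    [SecondCountableTopology M] [ChartedSpace (HamPoisson.Model m) M] [IsManifold (𝓡 m) ∞ M]
    (hM : HamPoisson.IsOrientable m M)
    (X : ∀ x : M, TangentSpace (𝓡 m) x)
    (hX : ContMDiff (𝓡 m) (𝓡 m).tangent ∞ (fun x => (⟨x, X x⟩ : TangentBundle (𝓡 m) M)))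
    (h : Fin (m - 1) → M → ℝ)
    (hsmooth : ∀ i, ContMDiff (𝓡 m) 𝓘(ℝ, ℝ) ∞ (h i))
    (hfirst : ∀ i x, HamPoisson.diff (m := m) (h i) x (X x) = 0)
    (hindep : ∀ x, LinearIndependent ℝ (fun i => HamPoisson.diff (m := m) (h i) x)) :
    (∃! π : Fin (m - 1) → HamPoisson.BivectorField m M,
      (∀ i, (π i).IsPoisson ∧ ∀ x, (π i).rank x ≤ 2) ∧
      ∀ i j x, (π i).sharpAt x (HamPoisson.diff (h j) x) = if i = j then X x else 0) ∧
    ∀ π : Fin (m - 1) → HamPoisson.BivectorField m M,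
      ((∀ i, (π i).IsPoisson ∧ ∀ x, (π i).rank x ≤ 2) ∧
        ∀ i j x, (π i).sharpAt x (HamPoisson.diff (h j) x) = if i = j then X x else 0) →
      ∀ i j, HamPoisson.SchoutenCommute (π i) (π j) := by
  -- The subtraction is truncated, so this relies on `1 ≤ m`.
  have hcard : m = Fintype.card (Fin (m - 1)) + 1 := by
    rw [Fintype.card_fin]
    omega
  have commute := fun {π σ i j} =>
    HamPoisson.schoutenCommute_of_sharpAt_diff (π := π) (σ := σ) (i := i) (j := j)
      hcard hX hsmooth hfirst hindep
  choose v hv using fun (i : Fin (m - 1)) (x : M) =>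
    HamPoisson.exists_forall_apply_eq (hindep x) (fun j => if i = j then 1 else 0)
  let ρ : Fin (m - 1) → HamPoisson.BivectorField m M := fun i =>
    HamPoisson.wedgeField hcard hX hsmooth hfirst hindep i (v i) (hv i)
  have hρ : ∀ i j x, (ρ i).sharpAt x (HamPoisson.diff (h j) x) = if i = j then X x else 0 :=
    fun i j x => (HamPoisson.sharpAt_diff_eq_iff (ρ i) i j x).2
      (HamPoisson.wedge_apply_of_dual (hv i x) (fun k => hfirst k x) j)
  refine ⟨⟨ρ, ⟨fun i => ⟨commute (hρ i) (hρ i), fun x =>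
    HamPoisson.finrank_range_sharp_wedge_le _ _⟩, hρ⟩, fun σ hσ => ?_⟩,
    fun π hπ i j => commute (hπ.2 i) (hπ.2 j)⟩
  funext i
  refine HamPoisson.BivectorField.ext (funext fun x => ?_)
  refine HamPoisson.Bivector.eq_of_forall_apply_eq (hindep x)
    ((HamPoisson.finrank_tangentSpace x).trans hcard) fun j β => ?_
  rw [(HamPoisson.sharpAt_diff_eq_iff (σ i) i j x).1 (hσ.2 i j x),
    (HamPoisson.sharpAt_diff_eq_iff (ρ i) i j x).1 (hρ i j x)]
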